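/- Let $n,p\ge 0$ be integers. For a conjugacy class $C$ in $GL(n,\mathbf C)$ or in $gl(n,\mathbf C)$ (in both cases under conjugation by $GL(n,\mathbf C)$) let $d(C)$ be its dimension as an algebraic variety over $\mathbf C$. The index of rigidity of a $(p+1)$-tuple of conjugacy classes $C_1,\dots,C_{p+1}$ is $2n^2-\sum_{j=1}^{p+1}d(C_j)$. A $(p+1)$-tuple of $n\times n$ matrices is called irreducible if $n>0$ and the only subspaces of $\mathbf C^n$ invariant under all the matrices are $0$ and $\mathbf C^n$. (Multiplicative version) Let $C_1,\dots,C_{p+1}$ be conjugacy classes in $GL(n,\mathbf C)$ with index of rigidity equal to $2$. Let $C_1^*,\dots,C_{p+1}^*$ be conjugacy classes in $GL(n,\mathbf C)$ such that $C_j^*$ lies in the closure of $C_j$ for every $j$, and $C_j^*\ne C_j$ for at least one $j$. If there exist matrices $M_j^*\in C_j^*$ with $M_1^*\cdots M_{p+1}^*=I$, then there is no irreducible $(p+1)$-tuple of matrices $M_j\in C_j$ with $M_1\cdots M_{p+1}=I$. (Additive version) Let $c_1,\dots,c_{p+1}$ be conjugacy classes in $gl(n,\mathbf C)$ with index of rigidity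 equal to $2$. Let $c_1^*,\dots,c_{p+1}^*$ be conjugacy classes in $gl(n,\mathbf C)$ such that $c_j^*$ lies in the closure of $c_j$ for every $j$, and $c_j^*\ne c_j$ for at least one $j$. If there exist matrices $A_j^*\in c_j^*$ with $A_1^*+\dots+A_{p+1}^*=0$, then there is no irreducible $(p+1)$-tuple of matrices $A_j\in c_j$ with $A_1+\dots+A_{p+1}=0$. -/

import Mathlib

open scoped MatrixGroups

noncomputable section

namespace DeligneSimpson

/-- The dimension of a (quasi-affine) subset `S` of the affine space `ℂ^σ`, i.e. the Krull
dimension of the coordinate ring `ℂ[σ] ⧸ I(S)` of its Zariski closure. For finite `σ` and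
non-empty `S` this number is finite and no default value is used, see `coe_zariskiDim`. -/
def zariskiDim {σ : Type*} (S : Set (σ → ℂ)) : ℕ :=
  ((ringKrullDim (MvPolynomial σ ℂ ⧸ MvPolynomial.vanishingIdeal ℂ S)).unbotD 0).toNat

theorem coe_zariskiDim {σ : Type*} [Finite σ] {S : Set (σ → ℂ)} (hS : S.Nonempty) :
    ((zariskiDim S : ℕ) : WithBot ℕ∞) =
      ringKrullDim (MvPolynomial σ ℂ ⧸ MvPolynomial.vanishingIdeal ℂ S) := by
  have hne : MvPolynomial.vanishingIdeal ℂ S ≠ ⊤ := by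
    intro h
    obtain ⟨x, hx⟩ := hS
    have h1 : (1 : MvPolynomial σ ℂ) ∈ MvPolynomial.vanishingIdeal ℂ S := h ▸ Submodule.mem_top
    have := (MvPolynomial.mem_vanishingIdeal_iff.mp h1) x hx
    simp at this
  have : Nontrivial (MvPolynomial σ ℂ ⧸ MvPolynomial.vanishingIdeal ℂ S) :=
    Ideal.Quotient.nontrivial_iff.mpr hne
  have hle : ringKrullDim (MvPolynomial σ ℂ ⧸ MvPolynomial.vanishingIdeal ℂ S) ≤
      ((Nat.card σ : ℕ) : WithBot ℕ∞) := by
    refine (ringKrullDim_quotient_le _).trans ?_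
    rw [MvPolynomial.ringKrullDim_of_isNoetherianRing, ringKrullDim_eq_zero_of_field, zero_add]
  have h0 : (0 : WithBot ℕ∞) ≤
      ringKrullDim (MvPolynomial σ ℂ ⧸ MvPolynomial.vanishingIdeal ℂ S) :=
    ringKrullDim_nonneg_of_nontrivial
  unfold zariskiDim
  revert hle h0
  generalize ringKrullDim (MvPolynomial σ ℂ ⧸ MvPolynomial.vanishingIdeal ℂ S) = d
  intro hle h0
  induction d with
  | bot => simp at h0
  | coe a =>
    have ha : a ≤ (Nat.card σ : ℕ∞) := by exact_mod_cast hle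
    have : a ≠ ⊤ := ne_top_of_le_ne_top (ENat.natCast_ne_top _) ha
    lift a to ℕ using this
    rfl

/-- The dimension of a set of `n × n` matrices, viewed as a subset of affine `n²`-space through
the matrix entries. -/
def matrixDim {n : ℕ} (S : Set (Matrix (Fin n) (Fin n) ℂ)) : ℕ :=
  zariskiDim ((fun (A : Matrix (Fin n) (Fin n) ℂ) (ij : Fin n × Fin n) => A ij.1 ij.2) '' S)

/-- The dimension `d(c)` of a conjugacy class `c ⊆ gl(n, ℂ)`. Here `ConjClasses` of the monoid of
all matrices is conjugacy under its unit group `GL(n, ℂ)`. -/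
def addDim {n : ℕ} (c : ConjClasses (Matrix (Fin n) (Fin n) ℂ)) : ℕ :=
  matrixDim c.carrier

/-- The dimension `d(C)` of a conjugacy class `C ⊆ GL(n, ℂ)`. -/
def mulDim {n : ℕ} (C : ConjClasses (GL (Fin n) ℂ)) : ℕ :=
  matrixDim ((fun g : GL (Fin n) ℂ => (g : Matrix (Fin n) (Fin n) ℂ)) '' C.carrier)

/-- The index of rigidity `2 n² - ∑ d(C_j)` of a tuple of conjugacy classes in `GL(n, ℂ)`. -/
def mulIndexOfRigidity {n p : ℕ} (C : Fin (p + 1) → ConjClasses (GL (Fin n) ℂ)) : ℤ :=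
  2 * (n : ℤ) ^ 2 - ∑ j, (mulDim (C j) : ℤ)

/-- The index of rigidity `2 n² - ∑ d(c_j)` of a tuple of conjugacy classes in `gl(n, ℂ)`. -/
def addIndexOfRigidity {n p : ℕ}
    (c : Fin (p + 1) → ConjClasses (Matrix (Fin n) (Fin n) ℂ)) : ℤ :=
  2 * (n : ℤ) ^ 2 - ∑ j, (addDim (c j) : ℤ)

/-- A conjugacy class `a` is subordinate to `b` if it lies in the closure of `b`. -/
def Subordinate {M : Type*} [Monoid M] [TopologicalSpace M] (a b : ConjClasses M) : Prop :=
  a.carrier ⊆ closure b.carrier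

/-- A tuple of `n × n` matrices, `n > 0`, is irreducible if it has no common invariant subspace
other than `0` and `ℂⁿ`. -/
def IsIrreducible {n p : ℕ} (A : Fin (p + 1) → Matrix (Fin n) (Fin n) ℂ) : Prop :=
  0 < n ∧ ∀ W : Submodule ℂ (Fin n → ℂ),
    (∀ j, ∀ v ∈ W, (A j).mulVec v ∈ W) → W = ⊥ ∨ W = ⊤

/-- `M_1 ⋯ M_{p+1} = I`, the product taken in this order. -/
def ProdEqOne {n p : ℕ} (M : Fin (p + 1) → GL (Fin n) ℂ) : Prop :=
  (List.ofFn M).prod = 1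

/-- The multiplicative Deligne-Simpson problem has a solution for the classes `C_j`. -/
def MulDSPSolvable {n p : ℕ} (C : Fin (p + 1) → ConjClasses (GL (Fin n) ℂ)) : Prop :=
  ∃ M : Fin (p + 1) → GL (Fin n) ℂ, (∀ j, M j ∈ (C j).carrier) ∧ ProdEqOne M ∧
    IsIrreducible (fun j => (M j : Matrix (Fin n) (Fin n) ℂ))

/-- The additive Deligne-Simpson problem has a solution for the classes `c_j`. -/
def AddDSPSolvable {n p : ℕ}
    (c : Fin (p + 1) → ConjClasses (Matrix (Fin n) (Fin n) ℂ)) : Prop :=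
  ∃ A : Fin (p + 1) → Matrix (Fin n) (Fin n) ℂ, (∀ j, A j ∈ (c j).carrier) ∧ ∑ j, A j = 0 ∧
    IsIrreducible A

end DeligneSimpson

end

/-! Let `A` be an irreducible solution and `B` a solution in the smaller classes. The rank of `X ↦
A_j X - X B_j` is at most that of `X ↦ A_j X - X A_j`, since rank is lower semicontinuous and `B_j`
is a limit of conjugates of `A_j`; the latter is the rank of the orbit map at the identity, hence at
most `d(C_j)`. Index 2 makes these ranks sum to at most `2n² - 2`. The relations on `A` and `B` give
a complex `V → ⨁ W_j → V`, with `V` the space of matrices and `W_j` the ranges (Scott's lemma), so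
its first map is not injective or its second not surjective. Either failure, the second through the
trace form, yields a nonzero intertwiner between `A` and `B`. By irreducibility it is invertible, so
`A_j` and `B_j` are conjugate for every `j`, against `C_j^* ≠ C_j` for some `j`. -/

/-! ### Lower bounds for Krull dimension. -/

/-- Lying over gives a prime above the bottom of a chain, and going up lifts the rest. -/
theorem ringKrullDim_le_of_isIntegral_of_injective {R S : Type*} [CommRing R] [CommRing S]
    (f : R →+* S) (hf : Function.Injective f) (hi : f.IsIntegral) :
    ringKrullDim R ≤ ringKrullDim S := by
  algebraize [f]
  refine iSup_le fun l => ?_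
  obtain ⟨P, -, hP, hPl⟩ := Ideal.exists_ideal_over_prime_of_isIntegral
    l.head.asIdeal (⊥ : Ideal S) (by
      exact (Ideal.comap_bot_of_injective f hf).trans_le bot_le)
  have : P.LiesOver l.head.asIdeal := ⟨hPl.symm⟩
  obtain ⟨L, hL, -, -⟩ := Ideal.exists_ltSeries_of_hasGoingUp l P
  rw [← hL]
  exact le_iSup (fun L : LTSeries (PrimeSpectrum S) => ((L.length : ℕ) : WithBot ℕ∞)) L

/-- A finitely generated algebra over a field which contains a polynomial ring in `r` variables
has Krull dimension at least `r`. -/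
theorem natCast_le_ringKrullDim_of_injective.{u, v} {k : Type u} {A : Type v} [Field k] [CommRing A] [Algebra k A]
    [Algebra.FiniteType k A] {r : ℕ} (g : MvPolynomial (Fin r) k →ₐ[k] A)
    (hg : Function.Injective g) : (r : WithBot ℕ∞) ≤ ringKrullDim A := by
  -- A prime contracting to zero: the polynomial ring still embeds in the domain `A ⧸ P`, where
  -- transcendence degrees can be compared.
  obtain ⟨P, hP, hPg⟩ := Ideal.exists_comap_eq_of_mem_minimalPrimes_of_injective
    (f := g.toRingHom) hg ⊥ (by simp [IsDomain.minimalPrimes_eq_singleton_bot])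
  have hinj : Function.Injective ((Ideal.Quotient.mkₐ k P).comp g) := by
    rw [injective_iff_map_eq_zero]
    intro x hx
    have : g x ∈ P := Ideal.Quotient.eq_zero_iff_mem.mp hx
    change x ∈ Ideal.comap g.toRingHom P at this
    rwa [hPg] at this
  -- Noether normalization: `s` is the transcendence degree of `A ⧸ P` and bounds its dimension from
  -- below.
  obtain ⟨s, f, hf, hfi⟩ := exists_integral_inj_algHom_of_fg k (A ⧸ P)
  have hrs : r ≤ s := by
    have h1 := lift_trdeg_le_of_injective _ hinj
    have h2 : Cardinal.lift.{u} (Algebra.trdeg k (A ⧸ P)) =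
        Cardinal.lift.{v} (Algebra.trdeg k (MvPolynomial (Fin s) k)) := by
      algebraize [f.toRingHom]
      have : IsScalarTower k (MvPolynomial (Fin s) k) (A ⧸ P) :=
        IsScalarTower.of_algebraMap_eq fun x => (f.commutes x).symm
      have : FaithfulSMul (MvPolynomial (Fin s) k) (A ⧸ P) :=
        (faithfulSMul_iff_algebraMap_injective _ _).mpr hf
      have h := lift_trdeg_add_eq k (MvPolynomial (Fin s) k) (A ⧸ P)
      rw [trdeg_eq_zero (R := MvPolynomial (Fin s) k) (A := A ⧸ P)] at h
      simpa using h.symm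
    rw [h2] at h1
    simpa [MvPolynomial.trdeg_of_isDomain] using h1
  calc (r : WithBot ℕ∞) ≤ (s : WithBot ℕ∞) := by exact_mod_cast hrs
    _ = ringKrullDim (MvPolynomial (Fin s) k) := by
      rw [MvPolynomial.ringKrullDim_of_isNoetherianRing, ringKrullDim_eq_zero_of_field]
      simp
    _ ≤ ringKrullDim (A ⧸ P) := ringKrullDim_le_of_isIntegral_of_injective f.toRingHom hf hfi
    _ ≤ ringKrullDim A := ringKrullDim_quotient_le P

/-- A polynomial vanishing on a nonempty open subset of `𝕜ⁿ` is zero. -/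
theorem MvPolynomial.eq_zero_of_eventually_eval_eq_zero {ι 𝕜 : Type*} [Finite ι]
    [NontriviallyNormedField 𝕜] {p : MvPolynomial ι 𝕜} {x : ι → 𝕜}
    (h : ∀ᶠ y in nhds x, MvPolynomial.eval y p = 0) : p = 0 := by
  have := Fintype.ofFinite ι
  obtain ⟨ε, hε, hball⟩ := Metric.eventually_nhds_iff_ball.mp h
  refine MvPolynomial.funext_set (fun i => Metric.ball (x i) ε)
    (fun i => infinite_of_mem_nhds (x i) (Metric.ball_mem_nhds _ hε)) fun y hy => ?_
  rw [map_zero]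
  exact hball y (by rw [ball_pi _ hε]; exact hy)

namespace DeligneSimpson

/-- If `F` maps a neighbourhood of `x` into `S`, then the rank of the derivative of `F` at `x` is
at most the dimension of the Zariski closure of `S`. -/
theorem finrank_range_le_zariskiDim {σ E : Type*} [Fintype σ] [NormedAddCommGroup E]
    [NormedSpace ℂ E] [CompleteSpace E] {S : Set (σ → ℂ)} {F : E → σ → ℂ}
    {F' : E →L[ℂ] σ → ℂ} {x : E} (hF : HasStrictFDerivAt F F' x)
    (hS : ∀ᶠ y in nhds x, F y ∈ S) :
    Module.finrank ℂ (LinearMap.range F'.toLinearMap) ≤ zariskiDim S := by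
  classical
  set r := Module.finrank ℂ (LinearMap.range F'.toLinearMap) with hr
  -- Coordinates on the range of `F'`, extended to the whole space, make `l ∘ F` a submersion at
  -- `x`. Its image contains an open set, so the `r` linear forms `q` are algebraically independent
  -- on `S`.
  obtain ⟨l, hl⟩ := LinearMap.exists_extend
    ((Module.finBasis ℂ (LinearMap.range F'.toLinearMap)).equivFun.toLinearMap)
  have hsurj : Function.Surjective (l.toContinuousLinearMap.comp F') := by
    intro y
    obtain ⟨⟨_, e, rfl⟩, he⟩ :=
      (Module.finBasis ℂ (LinearMap.range F'.toLinearMap)).equivFun.surjective y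
    exact ⟨e, (LinearMap.congr_fun hl _).trans he⟩
  have hlF : HasStrictFDerivAt (fun y => l.toContinuousLinearMap (F y))
      (l.toContinuousLinearMap.comp F') x :=
    l.toContinuousLinearMap.hasStrictFDerivAt.comp x hF
  have hmap := hlF.map_nhds_eq_of_surj (LinearMap.range_eq_top.mpr hsurj)
  let q : Fin r → MvPolynomial σ ℂ := fun i =>
    ∑ s, MvPolynomial.C (l (fun t => if s = t then 1 else 0) i) * MvPolynomial.X s
  have hq : ∀ (y : σ → ℂ) i, MvPolynomial.aeval y (q i) = l y i := by
    intro y i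
    conv_rhs => rw [LinearMap.pi_apply_eq_sum_univ l y]
    simp [q, mul_comm]
  let g : MvPolynomial (Fin r) ℂ →ₐ[ℂ] MvPolynomial σ ℂ ⧸ MvPolynomial.vanishingIdeal ℂ S :=
    (Ideal.Quotient.mkₐ ℂ _).comp (MvPolynomial.aeval q)
  have hg : Function.Injective g := by
    rw [injective_iff_map_eq_zero]
    intro p hp
    have hp : MvPolynomial.aeval q p ∈ MvPolynomial.vanishingIdeal ℂ S :=
      Ideal.Quotient.eq_zero_iff_mem.mp hp
    have hev : ∀ y ∈ S, MvPolynomial.eval (l y) p = 0 := by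
      intro y hy
      have h1 := MvPolynomial.mem_vanishingIdeal_iff.mp hp y hy
      rw [← AlgHom.comp_apply, MvPolynomial.comp_aeval] at h1
      simp only [hq] at h1
      rwa [MvPolynomial.aeval_eq_eval] at h1
    refine MvPolynomial.eq_zero_of_eventually_eval_eq_zero (x := l (F x)) ?_
    change ∀ᶠ y in nhds (l.toContinuousLinearMap (F x)), _
    rw [← hmap, Filter.eventually_map]
    exact hS.mono fun y hy => hev _ hy
  have h := natCast_le_ringKrullDim_of_injective g hg
  rw [← coe_zariskiDim ⟨_, hS.self_of_nhds⟩] at h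
  exact_mod_cast h

end DeligneSimpson

/-- The linear map `X ↦ A X - X B`. -/
def Matrix.intertwiningDefect {n R : Type*} [Fintype n] [DecidableEq n] [CommRing R]
    (A B : Matrix n n R) : Matrix n n R →ₗ[R] Matrix n n R :=
  LinearMap.mulLeft R A - LinearMap.mulRight R B

@[simp]
theorem Matrix.intertwiningDefect_apply {n R : Type*} [Fintype n] [DecidableEq n] [CommRing R]
    (A B X : Matrix n n R) : Matrix.intertwiningDefect A B X = A * X - X * B := rfl

/-! ### Tangent spaces and semicontinuity of rank. -/

section Analytic

attribute [local instance] Matrix.linftyOpNormedRing Matrix.linftyOpNormedAlgebra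

namespace DeligneSimpson

/-- The tangent space at `A` to the conjugacy class of `A` bounds the dimension from below. -/
theorem finrank_range_intertwiningDefect_self_le_matrixDim {n : ℕ} {A : Matrix (Fin n) (Fin n) ℂ}
    {S : Set (Matrix (Fin n) (Fin n) ℂ)}
    (hS : ∀ g : (Matrix (Fin n) (Fin n) ℂ)ˣ, g.val * A * g⁻¹.val ∈ S) :
    Module.finrank ℂ (LinearMap.range (A.intertwiningDefect A)) ≤ matrixDim S := by
  let L : Matrix (Fin n) (Fin n) ℂ →ₗ[ℂ] (Fin n × Fin n → ℂ) :=
    { toFun := fun X ij => X ij.1 ij.2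
      map_add' := fun _ _ => rfl
      map_smul' := fun _ _ => rfl }
  have hL : Function.Injective L := fun X Y h => by
    ext i j
    exact congrFun h (i, j)
  -- `Ring.inverse` is zero off the units, which is harmless because the units are a neighbourhood
  -- of `1`.
  have h1 : HasStrictFDerivAt (fun Y : Matrix (Fin n) (Fin n) ℂ => Y * A * Ring.inverse Y)
      (LinearMap.toContinuousLinearMap (-A.intertwiningDefect A)) 1 := by
    refine (((hasStrictFDerivAt_id (𝕜 := ℂ) (1 : Matrix (Fin n) (Fin n) ℂ)).mul_const' A).mul'
      (hasStrictFDerivAt_ringInverse (𝕜 := ℂ) (1 : (Matrix (Fin n) (Fin n) ℂ)ˣ))).congr_fderiv ?_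
    ext X : 1
    trans -(A * X) + X * A
    · simp
      rfl
    · exact (neg_add_eq_sub _ _).trans (neg_sub _ _).symm
  have h2 : HasStrictFDerivAt (fun Y : Matrix (Fin n) (Fin n) ℂ => L (Y * A * Ring.inverse Y))
      (LinearMap.toContinuousLinearMap (L ∘ₗ (-A.intertwiningDefect A))) 1 :=
    L.toContinuousLinearMap.hasStrictFDerivAt.comp (1 : Matrix (Fin n) (Fin n) ℂ) h1
  refine le_trans (le_of_eq ?_) (finrank_range_le_zariskiDim h2 ?_)
  · rw [LinearMap.coe_toContinuousLinearMap, LinearMap.range_comp, LinearMap.range_neg,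
      ((A.intertwiningDefect A).range.equivMapOfInjective L hL).finrank_eq]
  · have hu : ∀ᶠ Y : Matrix (Fin n) (Fin n) ℂ in nhds 1, IsUnit Y :=
      Units.isOpen.mem_nhds isUnit_one
    filter_upwards [hu]
    rintro _ ⟨g, rfl⟩
    exact ⟨_, hS g, by simp only [Ring.inverse_unit]; rfl⟩

end DeligneSimpson

/-- The rank of `X ↦ A X - X B` does not exceed that of `X ↦ A X - X A` when `B` is a limit of
conjugates of `A`. -/
theorem Matrix.finrank_range_intertwiningDefect_le_of_mem_closure {n : ℕ}
    {A B : Matrix (Fin n) (Fin n) ℂ} {S : Set (Matrix (Fin n) (Fin n) ℂ)}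
    (hS : ∀ X ∈ S, IsConj A X) (hB : B ∈ closure S) :
    Module.finrank ℂ (LinearMap.range (A.intertwiningDefect B)) ≤
      Module.finrank ℂ (LinearMap.range (A.intertwiningDefect A)) := by
  set r := Module.finrank ℂ (LinearMap.range (A.intertwiningDefect A)) with hr
  let T : Matrix (Fin n) (Fin n) ℂ → Matrix (Fin n) (Fin n) ℂ →L[ℂ] Matrix (Fin n) (Fin n) ℂ :=
    fun X => ContinuousLinearMap.mul ℂ _ A - (ContinuousLinearMap.mul ℂ _).flip X
  have hT : Continuous T :=
    continuous_const.sub (ContinuousLinearMap.mul ℂ (Matrix (Fin n) (Fin n) ℂ)).flip.continuous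
  have hTr : ∀ X (k : ℕ), (k : Cardinal) ≤ (T X).toLinearMap.rank ↔
      k ≤ Module.finrank ℂ (LinearMap.range (A.intertwiningDefect X)) := by
    intro X k
    rw [← Nat.cast_le (α := Cardinal), Module.finrank_eq_rank]
    rfl
  by_contra! hlt
  obtain ⟨X, hX, hXS⟩ := mem_closure_iff.mp hB _
    ((isOpen_setOfPred_nat_le_rank (r + 1)).preimage hT) ((hTr B _).mpr hlt)
  have hX : r + 1 ≤ _ := (hTr X _).mp hX
  obtain ⟨g, hg⟩ := hS X hXS
  -- For `X = g A g⁻¹`, `A Y - Y X = (A (Y g) - (Y g) A) g⁻¹`.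
  have hle : LinearMap.range (A.intertwiningDefect X) ≤
      (LinearMap.range (A.intertwiningDefect A)).map (LinearMap.mulRight ℂ (↑g⁻¹ : Matrix _ _ ℂ)) := by
    rintro _ ⟨Y, rfl⟩
    refine ⟨_, ⟨Y * g.val, rfl⟩, ?_⟩
    have h1 : X * g.val = g.val * A := hg.symm
    rw [LinearMap.mulRight_apply, Matrix.intertwiningDefect_apply, Matrix.intertwiningDefect_apply,
      mul_assoc Y, ← h1, sub_mul, ← mul_assoc A, ← mul_assoc Y, Units.mul_inv_cancel_right,
      Units.mul_inv_cancel_right]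
  have := (Submodule.finrank_mono hle).trans (Submodule.finrank_map_le _ _)
  omega

end Analytic

/-- Linear algebra behind Scott's lemma. -/
theorem exists_ne_zero_or_iSup_ne_top_of_sum_eq_zero {K V ι : Type*} [Field K] [AddCommGroup V]
    [Module K V] [FiniteDimensional K V] [Fintype ι] (W : ι → Submodule K V) (β : ι → V →ₗ[K] V)
    (hβW : ∀ i v, β i v ∈ W i) (hβ : ∀ v, ∑ i, β i v = 0)
    (hW : ∑ i, Module.finrank K (W i) < 2 * Module.finrank K V) :
    (∃ v ≠ 0, ∀ i, β i v = 0) ∨ ⨆ i, W i ≠ ⊤ := by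
  classical
  by_contra! h
  obtain ⟨h1, h2⟩ := h
  -- Here `d ∘ b = 0`; with `b` injective and `d` surjective, the middle term would have dimension
  -- at least `2 dim V`.
  let b : V →ₗ[K] ((i : ι) → W i) := LinearMap.pi fun i => (β i).codRestrict (W i) (hβW i)
  let d : ((i : ι) → W i) →ₗ[K] V := ∑ i, (W i).subtype ∘ₗ LinearMap.proj i
  have hb : Function.Injective b := by
    rw [injective_iff_map_eq_zero]
    intro v hv
    by_contra hne
    obtain ⟨i, hi⟩ := h1 v hne
    exact hi (congrArg Subtype.val (congrFun hv i))
  have hd : LinearMap.range d = ⊤ := by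
    rw [eq_top_iff, ← h2]
    refine iSup_le fun i w hw => ⟨Pi.single i ⟨w, hw⟩, ?_⟩
    simp only [d, LinearMap.sum_apply, LinearMap.comp_apply, LinearMap.proj_apply]
    rw [Finset.sum_eq_single i]
    · simp
    · intro j _ hj
      simp [Pi.single_eq_of_ne hj]
    · simp
  have hbd : LinearMap.range b ≤ LinearMap.ker d := by
    rintro _ ⟨v, rfl⟩
    simpa [d, b] using hβ v
  have e1 := Submodule.finrank_mono hbd
  have e2 := d.finrank_range_add_finrank_ker
  rw [LinearMap.finrank_range_of_inj hb] at e1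
  rw [hd, finrank_top, Module.finrank_pi_fintype] at e2
  omega

theorem Matrix.exists_eq_trace_mul {n R : Type*} [Fintype n] [DecidableEq n] [CommRing R]
    (f : Matrix n n R →ₗ[R] R) : ∃ Y : Matrix n n R, ∀ X, f X = (Y * X).trace := by
  refine ⟨Matrix.of fun i j => f (Matrix.single j i 1), fun X => ?_⟩
  suffices f = (Matrix.traceLinearMap n R R) ∘ₗ
      LinearMap.mulLeft R (Matrix.of fun i j => f (Matrix.single j i 1)) from
    LinearMap.congr_fun this X
  refine Matrix.ext_linearMap _ fun i j => ?_
  ext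
  simp [Matrix.trace_mul_single]

/-! ### Rigidity and the two versions of the theorem. -/

namespace DeligneSimpson

/-- Schur's argument: the range of `X` is invariant under `A`. -/
theorem IsIrreducible.isUnit_of_mul_eq_mul {n p : ℕ}
    {A B : Fin (p + 1) → Matrix (Fin n) (Fin n) ℂ} (hA : IsIrreducible A)
    {X : Matrix (Fin n) (Fin n) ℂ} (hX : X ≠ 0) (h : ∀ j, A j * X = X * B j) : IsUnit X := by
  rw [← Matrix.mulVec_surjective_iff_isUnit]
  rcases hA.2 (LinearMap.range X.mulVecLin) (by
    rintro j _ ⟨v, rfl⟩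
    exact ⟨(B j).mulVec v, by simp [h]⟩) with h0 | h0
  · exact absurd (Matrix.toLin'.map_eq_zero_iff.mp (LinearMap.range_eq_bot.mp h0)) hX
  · exact LinearMap.range_eq_top.mp h0

/-- Dually, the kernel of `Y` is invariant under `A`. -/
theorem IsIrreducible.isUnit_of_mul_eq_mul' {n p : ℕ}
    {A B : Fin (p + 1) → Matrix (Fin n) (Fin n) ℂ} (hA : IsIrreducible A)
    {Y : Matrix (Fin n) (Fin n) ℂ} (hY : Y ≠ 0) (h : ∀ j, Y * A j = B j * Y) : IsUnit Y := by
  rw [← Matrix.mulVec_injective_iff_isUnit]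
  rcases hA.2 (LinearMap.ker Y.mulVecLin) (by
    intro j v hv
    have hv : Y.mulVec v = 0 := hv
    rw [LinearMap.mem_ker, Matrix.mulVecLin_apply, Matrix.mulVec_mulVec, h, ← Matrix.mulVec_mulVec,
      hv, Matrix.mulVec_zero]) with h0 | h0
  · exact LinearMap.ker_eq_bot.mp h0
  · exact absurd (Matrix.toLin'.map_eq_zero_iff.mp (LinearMap.ker_eq_top.mp h0)) hY

/-- Katz's rigidity argument. -/
theorem IsIrreducible.isConj_of_sum_finrank_lt {n p : ℕ}
    {A B : Fin (p + 1) → Matrix (Fin n) (Fin n) ℂ} (hA : IsIrreducible A)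
    (β : Fin (p + 1) → Matrix (Fin n) (Fin n) ℂ →ₗ[ℂ] Matrix (Fin n) (Fin n) ℂ)
    (hβr : ∀ j X, β j X ∈ LinearMap.range ((A j).intertwiningDefect (B j)))
    (hβ : ∀ X, ∑ j, β j X = 0)
    (hβk : ∀ X, (∀ j, β j X = 0) → ∀ j, A j * X = X * B j)
    (hsum : ∑ j, Module.finrank ℂ (LinearMap.range ((A j).intertwiningDefect (B j))) < 2 * n ^ 2)
    (j : Fin (p + 1)) : IsConj (A j) (B j) := by
  rcases exists_ne_zero_or_iSup_ne_top_of_sum_eq_zero _ β hβr hβ (by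
    simpa [Module.finrank_matrix, sq] using hsum) with ⟨X, hX, h⟩ | h
  · have hX' := hβk X h
    obtain ⟨u, rfl⟩ := hA.isUnit_of_mul_eq_mul hX hX'
    exact IsConj.symm ⟨u, (hX' j).symm⟩
  -- A nonzero functional kills all the ranges. Written as `X ↦ tr (Y X)`, its vanishing says `Y A_j
  -- = B_j Y`, by cyclicity of the trace.
  · obtain ⟨f, hf, hle⟩ := Submodule.exists_le_ker_of_lt_top _ (lt_top_iff_ne_top.mpr h)
    obtain ⟨Y, hY⟩ := Matrix.exists_eq_trace_mul f
    have hY0 : Y ≠ 0 := by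
      rintro rfl
      exact hf (LinearMap.ext fun X => by simp [hY])
    have hYA : ∀ j, Y * A j = B j * Y := by
      intro j
      refine Matrix.ext_iff_trace_mul_right.mpr fun X => ?_
      have h0 : f ((A j).intertwiningDefect (B j) X) = 0 :=
        hle (Submodule.mem_iSup_of_mem (p := fun j =>
          LinearMap.range ((A j).intertwiningDefect (B j))) j ⟨X, rfl⟩)
      rw [hY, Matrix.intertwiningDefect_apply, mul_sub, Matrix.trace_sub, sub_eq_zero] at h0
      rw [mul_assoc, h0, ← mul_assoc, Matrix.trace_mul_comm, mul_assoc]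
    obtain ⟨u, rfl⟩ := hA.isUnit_of_mul_eq_mul' hY0 hYA
    exact ⟨u, hYA j⟩

theorem finrank_range_le_addDim {n : ℕ} {c cstar : ConjClasses (Matrix (Fin n) (Fin n) ℂ)}
    (h : Subordinate cstar c) {A B : Matrix (Fin n) (Fin n) ℂ} (hA : A ∈ c.carrier)
    (hB : B ∈ cstar.carrier) :
    Module.finrank ℂ (LinearMap.range (A.intertwiningDefect B)) ≤ addDim c := by
  rw [ConjClasses.mem_carrier_iff_mk_eq] at hA
  subst hA
  refine (Matrix.finrank_range_intertwiningDefect_le_of_mem_closure (fun X hX => ?_) (h hB)).trans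
    (finrank_range_intertwiningDefect_self_le_matrixDim fun g => ?_)
  · exact (ConjClasses.mk_eq_mk_iff_isConj.mp (ConjClasses.mem_carrier_iff_mk_eq.mp hX)).symm
  · rw [ConjClasses.mem_carrier_iff_mk_eq, ConjClasses.mk_eq_mk_iff_isConj]
    exact IsConj.symm ⟨g, by rw [SemiconjBy, mul_assoc, Units.inv_mul, mul_one]⟩

theorem finrank_range_le_mulDim {n : ℕ} {C Cstar : ConjClasses (GL (Fin n) ℂ)}
    (h : Subordinate Cstar C) {A B : GL (Fin n) ℂ} (hA : A ∈ C.carrier)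
    (hB : B ∈ Cstar.carrier) :
    Module.finrank ℂ (LinearMap.range
      ((A : Matrix (Fin n) (Fin n) ℂ).intertwiningDefect (B : Matrix (Fin n) (Fin n) ℂ))) ≤
      mulDim C := by
  rw [ConjClasses.mem_carrier_iff_mk_eq] at hA
  subst hA
  refine (Matrix.finrank_range_intertwiningDefect_le_of_mem_closure (fun X hX => ?_)
    (image_closure_subset_closure_image Units.continuous_val (Set.mem_image_of_mem _ (h hB)))).trans
    (finrank_range_intertwiningDefect_self_le_matrixDim fun g => ⟨g * A * g⁻¹, ?_, rfl⟩)
  · obtain ⟨g, hg, rfl⟩ := hX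
    obtain ⟨u, hu⟩ := isConj_iff.mp
      (ConjClasses.mk_eq_mk_iff_isConj.mp (ConjClasses.mem_carrier_iff_mk_eq.mp hg)).symm
    exact ⟨u, by simp [SemiconjBy, ← hu, mul_assoc]⟩
  · rw [ConjClasses.mem_carrier_iff_mk_eq, ConjClasses.mk_eq_mk_iff_isConj]
    exact IsConj.symm (isConj_iff.mpr ⟨g, rfl⟩)

theorem not_addDSPSolvable {n p : ℕ}
    {c cstar : Fin (p + 1) → ConjClasses (Matrix (Fin n) (Fin n) ℂ)}
    (hc : addIndexOfRigidity c = 2) (hsub : ∀ j, Subordinate (cstar j) (c j))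
    (hne : ∃ j, cstar j ≠ c j)
    (hstar : ∃ A : Fin (p + 1) → Matrix (Fin n) (Fin n) ℂ,
      (∀ j, A j ∈ (cstar j).carrier) ∧ ∑ j, A j = 0) : ¬ AddDSPSolvable c := by
  rintro ⟨A, hA, hA0, hirr⟩
  obtain ⟨B, hB, hB0⟩ := hstar
  obtain ⟨j, hj⟩ := hne
  have hconj := hirr.isConj_of_sum_finrank_lt (B := B)
    (fun j => (A j).intertwiningDefect (B j)) (fun j X => ⟨X, rfl⟩)
    (fun X => by simp [Finset.sum_sub_distrib, ← Finset.sum_mul, ← Finset.mul_sum, hA0, hB0])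
    (fun X h j => sub_eq_zero.mp (h j)) (by
      have h1 : ∑ j, Module.finrank ℂ (LinearMap.range ((A j).intertwiningDefect (B j))) ≤
          ∑ j, addDim (c j) :=
        Finset.sum_le_sum fun j _ => finrank_range_le_addDim (hsub j) (hA j) (hB j)
      unfold addIndexOfRigidity at hc
      zify at h1 ⊢
      linarith) j
  apply hj
  rw [← ConjClasses.mem_carrier_iff_mk_eq.mp (hA j), ← ConjClasses.mem_carrier_iff_mk_eq.mp (hB j)]
  exact (ConjClasses.mk_eq_mk_iff_isConj.mpr hconj).symm

theorem not_mulDSPSolvable {n p : ℕ} {C Cstar : Fin (p + 1) → ConjClasses (GL (Fin n) ℂ)}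
    (hC : mulIndexOfRigidity C = 2) (hsub : ∀ j, Subordinate (Cstar j) (C j))
    (hne : ∃ j, Cstar j ≠ C j)
    (hstar : ∃ M : Fin (p + 1) → GL (Fin n) ℂ,
      (∀ j, M j ∈ (Cstar j).carrier) ∧ ProdEqOne M) : ¬ MulDSPSolvable C := by
  rintro ⟨A, hA, hA1, hirr⟩
  obtain ⟨B, hB, hB1⟩ := hstar
  obtain ⟨j, hj⟩ := hne
  have hlast : ∀ M : Fin (p + 1) → GL (Fin n) ℂ, ProdEqOne M →
      Fin.partialProd M (Fin.last _) = 1 := by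
    intro M hM
    rw [Fin.partialProd, List.take_of_length_le (by simp)]
    exact hM
  -- `γ_k X = (A_1 ⋯ A_k)⁻¹ X (B_1 ⋯ B_k)` is the identity for `k = 0` and, by the product
  -- relations, for `k = p + 1`; hence the differences `γ_{j-1} - γ_j` telescope to zero.
  let γ : Fin (p + 2) → Matrix (Fin n) (Fin n) ℂ →ₗ[ℂ] Matrix (Fin n) (Fin n) ℂ := fun k =>
    LinearMap.mulLeft ℂ (↑(Fin.partialProd A k)⁻¹ : Matrix (Fin n) (Fin n) ℂ) ∘ₗ
      LinearMap.mulRight ℂ (↑(Fin.partialProd B k) : Matrix (Fin n) (Fin n) ℂ)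
  have hγ0 : ∀ X, γ 0 X = X := fun X => by simp [γ]
  have hγs : ∀ j X, γ (Fin.succ j) X = (↑(A j)⁻¹ : Matrix (Fin n) (Fin n) ℂ) *
      γ (Fin.castSucc j) X * (B j : Matrix (Fin n) (Fin n) ℂ) := fun j X => by
    simp only [γ, Fin.partialProd_succ, mul_inv_rev, Units.val_mul, LinearMap.comp_apply,
      LinearMap.mulLeft_apply, LinearMap.mulRight_apply, mul_assoc]
  have hconj := hirr.isConj_of_sum_finrank_lt (B := fun j => (B j : Matrix (Fin n) (Fin n) ℂ))
    (fun j => γ j.castSucc - γ j.succ)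
    (fun j X => ⟨(↑(A j)⁻¹ : Matrix (Fin n) (Fin n) ℂ) * γ j.castSucc X, by
      simp only [Matrix.intertwiningDefect_apply, LinearMap.sub_apply, hγs, Units.mul_inv_cancel_left]⟩)
    (fun X => by
      have h := (Fin.sum_univ_succ fun k => γ k X).symm.trans (Fin.sum_univ_castSucc fun k => γ k X)
      have hl : γ (Fin.last _) X = X := by simp [γ, hlast A hA1, hlast B hB1]
      rw [hγ0, hl, add_comm] at h
      simp only [LinearMap.sub_apply, Finset.sum_sub_distrib, sub_eq_zero]
      exact (add_right_cancel h).symm)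
    -- If all differences vanish at `X`, every `γ_k` fixes `X`, so `X = A_j⁻¹ X B_j`.
    (fun X h j => by
      have hk : ∀ k, γ k X = X := fun k => by
        induction k using Fin.induction with
        | zero => exact hγ0 X
        | succ k ih => exact (sub_eq_zero.mp (h k)).symm.trans ih
      have hj := hγs j X
      rw [hk, hk] at hj
      conv_lhs => rw [hj]
      rw [mul_assoc, Units.mul_inv_cancel_left]) (by
      have h1 : ∑ j, Module.finrank ℂ (LinearMap.range
          ((A j : Matrix (Fin n) (Fin n) ℂ).intertwiningDefect (B j : Matrix (Fin n) (Fin n) ℂ))) ≤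
          ∑ j, mulDim (C j) :=
        Finset.sum_le_sum fun j _ => finrank_range_le_mulDim (hsub j) (hA j) (hB j)
      unfold mulIndexOfRigidity at hC
      zify at h1 ⊢
      linarith) j
  apply hj
  rw [← ConjClasses.mem_carrier_iff_mk_eq.mp (hA j), ← ConjClasses.mem_carrier_iff_mk_eq.mp (hB j),
    ConjClasses.mk_eq_mk_iff_isConj]
  obtain ⟨u, hu⟩ := hconj.symm
  exact isConj_iff.mpr ⟨u, by
    rw [mul_inv_eq_iff_eq_mul]
    exact Units.ext hu⟩

end DeligneSimpson

theorem proposition1p16 (n p : ℕ) :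
    (∀ C Cstar : Fin (p + 1) → ConjClasses (GL (Fin n) ℂ),
      DeligneSimpson.mulIndexOfRigidity C = 2 →
      (∀ j, DeligneSimpson.Subordinate (Cstar j) (C j)) →
      (∃ j, Cstar j ≠ C j) →
      (∃ M : Fin (p + 1) → GL (Fin n) ℂ,
        (∀ j, M j ∈ (Cstar j).carrier) ∧ DeligneSimpson.ProdEqOne M) →
      ¬ DeligneSimpson.MulDSPSolvable C) ∧
    (∀ c cstar : Fin (p + 1) → ConjClasses (Matrix (Fin n) (Fin n) ℂ),
      DeligneSimpson.addIndexOfRigidity c = 2 →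
      (∀ j, DeligneSimpson.Subordinate (cstar j) (c j)) →
      (∃ j, cstar j ≠ c j) →
      (∃ A : Fin (p + 1) → Matrix (Fin n) (Fin n) ℂ,
        (∀ j, A j ∈ (cstar j).carrier) ∧ ∑ j, A j = 0) →
      ¬ DeligneSimpson.AddDSPSolvable c) :=
  ⟨fun _ _ hC hsub hne hstar => DeligneSimpson.not_mulDSPSolvable hC hsub hne hstar,
    fun _ _ hc hsub hne hstar => DeligneSimpson.not_addDSPSolvable hc hsub hne hstar⟩
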